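/- Let $n\ge 0$ and let $p_1\le\dots\le p_n$ and $q_1\ge\dots\ge q_n$ be nonnegative integers such that for each $1\le i<n$ at least one of $p_i<p_{i+1}$, $q_i>q_{i+1}$ holds. Let $x_1,x_2,\dots$ and $y_1,y_2,\dots$ be variables (or any elements of a commutative ring), and set $$a(i)=\frac{\prod_{b=1}^{q_i}(1+y_bT)}{\prod_{a=1}^{p_i}(1-x_aT)}=\sum_{m\ge 0}a(i)_m\,T^m ,\qquad a(i)_m=0\ \text{ for } m<0 .$$ Let $t$ be an integer, let $\lambda_i=q_i-p_i+i+t$ for $1\le i\le n$ (a weakly decreasing sequence), and let $\mu_1\ge\dots\ge\mu_n$ be integers with $\mu_i\le\lambda_i$ for all $i$. The skew diagram $\lambda/\mu$ consists of the boxes $(i,j)$ (row $i$, column $j$) with $1\le i\le n$ and $\mu_i<j\le\lambda_i$; the content of the box $(i,j)$ is $c=j-i-t$. A tableau on $\lambda/\mu$ is a filling of these boxes, each box receiving either a plain positive integer $k$, or a primed positive integer $l'$, or a pair $(k,l')$ of such (a pair contains both a plain entry and a primed entry), such that: 1. in row $i$, every plain entry $k$ satisfies $1\le k\le p_i$ and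 every primed entry $l'$ satisfies $1\le l\le q_i$; 2. a box of content $c$ holds a plain $k$ alone only if $k\le -c$, a primed $l'$ alone only if $l\le c$, and a pair $(k,l')$ only if $l-k=c$; 3. plain entries weakly increase along rows and strictly increase down columns; primed entries strictly increase along rows and weakly increase down columns; 4. every box to the right of or below a box containing a plain (resp. primed) entry contains a plain (resp. primed) entry; 5. the entry immediately to the right of a pair $(k,l')$ has the form $(k+m,(l+m+1)')$, and the entry immediately below it has the form $(k+m+1,(l+m)')$, for some integer $m\ge 0$. The weight of a tableau is the product over its boxes of $x_k$ for an entry $k$, $y_l$ for an entry $l'$, and $x_k+y_l$ for an entry $(k,l')$. Then $$S_{\lambda/\mu}(a(\bullet)):=\det\bigl(a(k)_{\lambda_k-\mu_l+l-k}\bigr)_{1\le k,l\le n}$$ equals the sum of the weights of all tableaux on $\lambda/\mu$. -/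

import Mathlib

/-- The series `∏_{b=1}^{q} (1 + y_b T) / ∏_{a=1}^{p} (1 - x_a T)` in `R⟦T⟧`. -/
noncomputable def chernSeries {R : Type*} [CommRing R] (x y : ℕ → R) (p q : ℕ) :
    PowerSeries R :=
  (∏ b ∈ Finset.Icc 1 q, (1 + PowerSeries.C (y b) * PowerSeries.X)) *
    PowerSeries.invOfUnit
      (∏ a ∈ Finset.Icc 1 p, (1 - PowerSeries.C (x a) * PowerSeries.X)) 1

/-- The quotient in `chernSeries` is a genuine one. -/
theorem chernSeries_mul {R : Type*} [CommRing R] (x y : ℕ → R) (p q : ℕ) :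
    chernSeries x y p q *
        (∏ a ∈ Finset.Icc 1 p, (1 - PowerSeries.C (x a) * PowerSeries.X)) =
      ∏ b ∈ Finset.Icc 1 q, (1 + PowerSeries.C (y b) * PowerSeries.X) := by
  unfold chernSeries
  rw [mul_assoc, PowerSeries.invOfUnit_mul, mul_one]
  simp [map_prod]

/-- The coefficient of `T ^ m` for an integer `m`; it is zero for negative `m`. -/
noncomputable def coeffInt {R : Type*} [CommRing R] (f : PowerSeries R) (m : ℤ) : R :=
  if 0 ≤ m then PowerSeries.coeff m.toNat f else 0

/-- `S_{lam/mu}(a(•)) = det (a(k)_{lam_k - mu_l + l - k})`. -/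
noncomputable def schurDet {R : Type*} [CommRing R] {n : ℕ} (a : Fin n → PowerSeries R)
    (lam mu : Fin n → ℤ) : R :=
  Matrix.det (Matrix.of fun k l : Fin n =>
    coeffInt (a k) (lam k - mu l + ((l : ℕ) : ℤ) - ((k : ℕ) : ℤ)))

/-- The boxes `(i, j)` with `mu i < j ≤ lam i`. Rows are numbered from `0` by `Fin n`
(so `i : Fin n` is row number `i + 1`), columns by integers. -/
noncomputable def skewDiagram {n : ℕ} (lam mu : Fin n → ℤ) : Finset (Fin n × ℤ) :=
  Finset.univ.biUnion fun i => (Finset.Ioc (mu i) (lam i)).image fun j => (i, j)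

theorem mem_skewDiagram {n : ℕ} {lam mu : Fin n → ℤ} {b : Fin n × ℤ} :
    b ∈ skewDiagram lam mu ↔ mu b.1 < b.2 ∧ b.2 ≤ lam b.1 := by
  rcases b with ⟨i, j⟩
  simp [skewDiagram]

/-- The content of a box, `j - i - t` when it lies in row number `i` and column `j`. -/
def content {n : ℕ} (t : ℤ) (b : Fin n × ℤ) : ℤ :=
  b.2 - (((b.1 : ℕ) : ℤ) + 1) - t

/-- What a box may contain: a plain integer `k`, a primed integer `l'`, or a pair `(k, l')`. -/
inductive TabEntry : Type
  | plain (k : ℕ) : TabEntry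
  | primed (l : ℕ) : TabEntry
  | pair (k l : ℕ) : TabEntry

namespace TabEntry

/-- The plain integer occurring in an entry, if there is one. -/
def plainPart : TabEntry → Option ℕ
  | plain k => some k
  | primed _ => none
  | pair k _ => some k

/-- The integer occurring with a prime in an entry, if there is one. -/
def primedPart : TabEntry → Option ℕ
  | plain _ => none
  | primed l => some l
  | pair _ l => some l

/-- `k ↦ x_k`, `l' ↦ y_l`, `(k, l') ↦ x_k + y_l`. -/
def weight {R : Type*} [CommRing R] (x y : ℕ → R) : TabEntry → R
  | plain k => x k
  | primed l => y l
  | pair k l => x k + y l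

/-- The entries that a box of content `c` can hold: a plain `k` with `k ≤ -c`, a primed `l'`
with `l ≤ c`, a pair `(k, l')` with `l - k = c`. -/
def FitsContent (c : ℤ) : TabEntry → Prop
  | plain k => (k : ℤ) ≤ -c
  | primed l => (l : ℤ) ≤ c
  | pair k l => (l : ℤ) - (k : ℤ) = c

end TabEntry

/-- A filling of the boxes of the skew diagram. -/
abbrev Filling {n : ℕ} (lam mu : Fin n → ℤ) : Type :=
  {b : Fin n × ℤ // b ∈ skewDiagram lam mu} → TabEntry

/-- The mixed tableaux on `lam/mu` with flags `p` (plain) and `q` (primed). -/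
structure IsTableau {n : ℕ} (p q : Fin n → ℕ) (t : ℤ) (lam mu : Fin n → ℤ)
    (T : Filling lam mu) : Prop where
  plain_flag : ∀ b, ∀ k ∈ (T b).plainPart, 1 ≤ k ∧ k ≤ p b.1.1
  primed_flag : ∀ b, ∀ l ∈ (T b).primedPart, 1 ≤ l ∧ l ≤ q b.1.1
  fits : ∀ b, (T b).FitsContent (content t b.1)
  /-- A box to the right of one with a plain entry has a plain entry; likewise for primed. -/
  plain_right : ∀ b b', b.1.1 = b'.1.1 → b.1.2 < b'.1.2 →
    (T b).plainPart.isSome → (T b').plainPart.isSome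
  primed_right : ∀ b b', b.1.1 = b'.1.1 → b.1.2 < b'.1.2 →
    (T b).primedPart.isSome → (T b').primedPart.isSome
  /-- A box below one with a plain entry has a plain entry; likewise for primed. -/
  plain_below : ∀ b b', b.1.1 < b'.1.1 → b.1.2 = b'.1.2 →
    (T b).plainPart.isSome → (T b').plainPart.isSome
  primed_below : ∀ b b', b.1.1 < b'.1.1 → b.1.2 = b'.1.2 →
    (T b).primedPart.isSome → (T b').primedPart.isSome
  /-- Plain entries: weakly increasing along rows, strictly increasing down columns. -/
  plain_row : ∀ b b', b.1.1 = b'.1.1 → b.1.2 < b'.1.2 →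
    ∀ k ∈ (T b).plainPart, ∀ k' ∈ (T b').plainPart, k ≤ k'
  plain_col : ∀ b b', b.1.1 < b'.1.1 → b.1.2 = b'.1.2 →
    ∀ k ∈ (T b).plainPart, ∀ k' ∈ (T b').plainPart, k < k'
  /-- Primed entries: strictly increasing along rows, weakly increasing down columns. -/
  primed_row : ∀ b b', b.1.1 = b'.1.1 → b.1.2 < b'.1.2 →
    ∀ l ∈ (T b).primedPart, ∀ l' ∈ (T b').primedPart, l < l'
  primed_col : ∀ b b', b.1.1 < b'.1.1 → b.1.2 = b'.1.2 →
    ∀ l ∈ (T b).primedPart, ∀ l' ∈ (T b').primedPart, l ≤ l'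
  /-- The entry just right of a pair `(k, l')` is a pair `(k + m, (l + m + 1)')`. -/
  pair_right : ∀ b b', b.1.1 = b'.1.1 → b.1.2 + 1 = b'.1.2 →
    ∀ k l, T b = TabEntry.pair k l → ∃ m : ℕ, T b' = TabEntry.pair (k + m) (l + m + 1)
  /-- The entry just below a pair `(k, l')` is a pair `(k + m + 1, (l + m)')`. -/
  pair_below : ∀ b b', (b.1.1 : ℕ) + 1 = (b'.1.1 : ℕ) → b.1.2 = b'.1.2 →
    ∀ k l, T b = TabEntry.pair k l → ∃ m : ℕ, T b' = TabEntry.pair (k + m + 1) (l + m)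

theorem finite_isTableau {n : ℕ} (p q : Fin n → ℕ) (t : ℤ) (lam mu : Fin n → ℤ) :
    {T : Filling lam mu | IsTableau p q t lam mu T}.Finite := by
  have hfin : ∀ P Q : ℕ, {e : TabEntry | (∀ k ∈ e.plainPart, k ≤ P) ∧
      ∀ l ∈ e.primedPart, l ≤ Q}.Finite := by
    intro P Q
    refine ((((Set.finite_Iic P).image TabEntry.plain).union
      ((Set.finite_Iic Q).image TabEntry.primed)).union
      (((Set.finite_Iic P).prod (Set.finite_Iic Q)).image
        fun z => TabEntry.pair z.1 z.2)).subset ?_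
    rintro e ⟨h1, h2⟩
    cases e with
    | plain k => exact Or.inl (Or.inl ⟨k, h1 k rfl, rfl⟩)
    | primed l => exact Or.inl (Or.inr ⟨l, h2 l rfl, rfl⟩)
    | pair k l => exact Or.inr ⟨(k, l), ⟨h1 k rfl, h2 l rfl⟩, rfl⟩
  refine (Set.Finite.pi' (fun b : {b : Fin n × ℤ // b ∈ skewDiagram lam mu} =>
    hfin (p b.1.1) (q b.1.1))).subset ?_
  intro T hT b
  exact ⟨fun k hk => (hT.plain_flag b k hk).2, fun l hl => (hT.primed_flag b l hl).2⟩

/-- The finite set of all tableaux on `lam/mu`. -/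
noncomputable def tableaux {n : ℕ} (p q : Fin n → ℕ) (t : ℤ) (lam mu : Fin n → ℤ) :
    Finset (Filling lam mu) :=
  (finite_isTableau p q t lam mu).toFinset

theorem mem_tableaux {n : ℕ} {p q : Fin n → ℕ} {t : ℤ} {lam mu : Fin n → ℤ}
    {T : Filling lam mu} : T ∈ tableaux p q t lam mu ↔ IsTableau p q t lam mu T := by
  simp [tableaux]

/-- The weight of a filling: the product of the weights of its entries. -/
noncomputable def fillingWeight {R : Type*} [CommRing R] (x y : ℕ → R) {n : ℕ} {lam mu : Fin n → ℤ}
    (T : Filling lam mu) : R :=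
  ∏ b, (T b).weight x y

/-! Each entry is encoded by one integer g: in a box of content c its plain part is g and its primed
part is g + c, a part being absent when it is not positive. Content rises by one to the right and
falls by one downwards, so the mixed rules reduce to: g weakly increases along rows and strictly
increases down columns. Both flags become g ≤ p_i, since the last box of row i has content q_i -
p_i. With x and y extended by zero, the weight of a box is x_g + y_{g+c}; it vanishes when neither
part survives, so g may range over all integers above a sufficiently low bound L
(`flaggedSum_eq_sum_tableaux`).

What remains is a flagged Jacobi–Trudi identity for weights w(g, c)
(`det_contentMatrix_eq_flaggedSum`). One-row series satisfy h(P, c, s) = h(P-1, c, s) + w(P, c) h(P,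
c-1, s) (`rowCoeff_rec`): the last entry is either below P or equal to P. This is applied to the
first row k with the largest flag, to the determinant by linearity in row k and to the fillings
through the last box of that row. Each term lowers p_k or λ_k by one. If row k is empty or ends in
the same column as the next row, it cannot be shortened; then the extra determinant vanishes and no
filling has p_k at the end of row k. -/

/-! ### Flagged integer fillings -/

/-- Column-strict fillings `g` of the skew diagram `lam/mu` by integers in the range
`L < g (i, j) ≤ p i`, extended by zero to all boxes. -/
structure IsFlaggedFilling {n : ℕ} (L : ℤ) (p lam mu : Fin n → ℤ) (g : Fin n × ℤ → ℤ) : Prop where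
  off : ∀ i j, ¬ (mu i < j ∧ j ≤ lam i) → g (i, j) = 0
  lower : ∀ i j, mu i < j → j ≤ lam i → L < g (i, j)
  flag : ∀ i j, mu i < j → j ≤ lam i → g (i, j) ≤ p i
  row : ∀ i j, mu i < j → j + 1 ≤ lam i → g (i, j) ≤ g (i, j + 1)
  col : ∀ i i' : Fin n, ∀ j, (i : ℕ) + 1 = (i' : ℕ) → mu i < j → j ≤ lam i' → g (i, j) < g (i', j)

theorem finite_isFlaggedFilling {n : ℕ} (L : ℤ) (p lam mu : Fin n → ℤ) :
    {g | IsFlaggedFilling L p lam mu g}.Finite := by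
  classical
  have hfin : {f : {b : Fin n × ℤ // b ∈ skewDiagram lam mu} → ℤ |
      ∀ b, f b ∈ Set.Ioc L (p b.1.1)}.Finite :=
    Set.Finite.pi' fun b => Set.finite_Ioc _ _
  refine (hfin.image fun f b => if hb : b ∈ skewDiagram lam mu then f ⟨b, hb⟩ else 0).subset ?_
  intro g (hg : IsFlaggedFilling L p lam mu g)
  refine ⟨fun b => g b.1, ?_, ?_⟩
  · rintro ⟨⟨i, j⟩, hb⟩
    rw [mem_skewDiagram] at hb
    exact ⟨hg.lower i j hb.1 hb.2, hg.flag i j hb.1 hb.2⟩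
  · funext ⟨i, j⟩
    by_cases hb : (i, j) ∈ skewDiagram lam mu
    · simp [hb]
    · have := hg.off i j (by rwa [mem_skewDiagram] at hb)
      simp [hb, this]

/-- The finite set of all flagged fillings. -/
noncomputable def flaggedFillings {n : ℕ} (L : ℤ) (p lam mu : Fin n → ℤ) :
    Finset (Fin n × ℤ → ℤ) :=
  (finite_isFlaggedFilling L p lam mu).toFinset

theorem mem_flaggedFillings {n : ℕ} {L : ℤ} {p lam mu : Fin n → ℤ} {g : Fin n × ℤ → ℤ} :
    g ∈ flaggedFillings L p lam mu ↔ IsFlaggedFilling L p lam mu g := by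
  simp [flaggedFillings]

namespace IsFlaggedFilling

variable {n : ℕ} {L : ℤ} {p lam mu : Fin n → ℤ} {g : Fin n × ℤ → ℤ}

theorem row_le (hg : IsFlaggedFilling L p lam mu g) {i : Fin n} {j j' : ℤ} (hj : mu i < j)
    (hjj : j ≤ j') (hj' : j' ≤ lam i) : g (i, j) ≤ g (i, j') := by
  induction j', hjj using Int.leInduction with
  | base => exact le_rfl
  | succ m hm ih => exact (ih (by omega)).trans (hg.row i m (by omega) hj')

/-- Strictness gains at least one per row; the intermediate boxes lie in the diagram because both
boundaries are antitone. -/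
theorem col_add_le (hg : IsFlaggedFilling L p lam mu g) (hlam : Antitone lam) (hmu : Antitone mu)
    {i : Fin n} {j : ℤ} (hj : mu i < j) (d : ℕ) (i' : Fin n) (hi' : (i' : ℕ) = i + d)
    (hj' : j ≤ lam i') : g (i, j) + d ≤ g (i', j) := by
  induction d generalizing i' with
  | zero =>
    have : i' = i := Fin.ext (by omega)
    simp [this]
  | succ d ih =>
    have hlt : (i : ℕ) + d < n := by omega
    have hle : (⟨i + d, hlt⟩ : Fin n) ≤ i' := Fin.le_def.2 (by simp; omega)
    have hle' : i ≤ (⟨i + d, hlt⟩ : Fin n) := Fin.le_def.2 (by simp)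
    have h1 := ih ⟨i + d, hlt⟩ rfl (hj'.trans (hlam hle))
    have h2 := hg.col ⟨i + d, hlt⟩ i' j (by simp; omega) ((hmu hle').trans_lt hj) hj'
    push_cast
    omega

end IsFlaggedFilling

/-- A square matrix with a block of zeros too large for a permutation to avoid is singular. -/
theorem Matrix.det_eq_zero_of_block {R : Type*} [CommRing R] {n : ℕ} (M : Matrix (Fin n) (Fin n) R)
    (k : Fin n) (h : ∀ i j, k ≤ i → j ≤ k → M i j = 0) : M.det = 0 := by
  rw [Matrix.det_apply]
  refine Finset.sum_eq_zero fun σ _ => ?_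
  -- Pigeonhole: the k + 1 columns up to k cannot be injected into the k rows before k.
  obtain ⟨j, hj, hσ⟩ : ∃ j, j ≤ k ∧ k ≤ σ j := by
    by_contra! hcon
    have hcard := Finset.card_le_card_of_injOn (s := Finset.Iic k) (t := Finset.Iio k) σ
      (fun j hj => by simpa using hcon j (by simpa using hj)) σ.injective.injOn
    simp at hcard
  have h0 : ∏ i, M (σ i) i = 0 := Finset.prod_eq_zero (Finset.mem_univ j) (h _ _ hσ hj)
  simp [h0]

/-! ### Jacobi–Trudi for content-dependent weights -/

section Determinant

variable {R : Type*} [CommRing R] {n : ℕ}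

/-- The matrix with entries `h (p k) (content of the last box in row k) (content before row l)`. -/
def contentMatrix (h : ℤ → ℤ → ℤ → R) (t : ℤ) (p lam mu : Fin n → ℤ) : Matrix (Fin n) (Fin n) R :=
  Matrix.of fun k l => h (p k) (content t (k, lam k)) (content t (l, mu l))

/-- The generating function of the flagged fillings, with weights depending on contents. -/
noncomputable def flaggedSum (w : ℤ → ℤ → R) (L t : ℤ) (p lam mu : Fin n → ℤ) : R :=
  ∑ g ∈ flaggedFillings L p lam mu, ∏ b ∈ skewDiagram lam mu, w (g b) (content t b)

theorem det_contentMatrix_row {w : ℤ → ℤ → R} {h : ℤ → ℤ → ℤ → R}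
    (hrec : ∀ P c s, h P c s = h (P - 1) c s + w P c * h P (c - 1) s)
    (t : ℤ) (p lam mu : Fin n → ℤ) (k : Fin n) :
    (contentMatrix h t p lam mu).det =
      (contentMatrix h t (Function.update p k (p k - 1)) lam mu).det +
        w (p k) (content t (k, lam k)) *
          (contentMatrix h t p (Function.update lam k (lam k - 1)) mu).det := by
  have e : contentMatrix h t p lam mu = (contentMatrix h t p lam mu).updateRow k
      ((fun l => h (p k - 1) (content t (k, lam k)) (content t (l, mu l))) +
        w (p k) (content t (k, lam k)) •
          fun l => h (p k) (content t (k, lam k) - 1) (content t (l, mu l))) := by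
    ext i l
    by_cases hi : i = k
    · subst hi
      simp [contentMatrix, ← hrec]
    · simp [hi]
  rw [e, Matrix.det_updateRow_add, Matrix.det_updateRow_smul]
  congr 2
  · ext i l
    by_cases hi : i = k
    · subst hi
      simp [contentMatrix]
    · simp [hi, contentMatrix]
  · congr 1
    ext i l
    by_cases hi : i = k
    · subst hi
      have : content t (i, lam i - 1) = content t (i, lam i) - 1 := by
        simp only [content]
        ring
      simp [contentMatrix, this]
    · simp [hi, contentMatrix]

/-- Rows weakly increase, so bounding the last box of row k bounds the whole row. An empty row
imposes no condition on either side. -/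
theorem filter_flaggedFillings_lt {L : ℤ} {p lam mu : Fin n → ℤ} {k : Fin n} :
    ({g ∈ flaggedFillings L p lam mu | mu k < lam k → g (k, lam k) < p k}) =
      flaggedFillings L (Function.update p k (p k - 1)) lam mu := by
  ext g
  simp only [Finset.mem_filter, mem_flaggedFillings]
  constructor
  · rintro ⟨hg, hlt⟩
    refine ⟨hg.off, hg.lower, fun i j h1 h2 => ?_, hg.row, hg.col⟩
    by_cases hi : i = k
    · subst hi
      have h3 := hg.row_le h1 h2 le_rfl
      have h4 := hlt (by omega)
      simp only [Function.update_self]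
      omega
    · simpa [hi] using hg.flag i j h1 h2
  · intro hg
    have hk : mu k < lam k → g (k, lam k) < p k := fun h => by
      have := hg.flag k (lam k) h le_rfl
      simp only [Function.update_self] at this
      omega
    refine ⟨⟨hg.off, hg.lower, fun i j h1 h2 => ?_, hg.row, hg.col⟩, hk⟩
    by_cases hi : i = k
    · subst hi
      have := hg.flag i j h1 h2
      simp only [Function.update_self] at this
      omega
    · simpa [hi] using hg.flag i j h1 h2

theorem skewDiagram_eq_insert {lam mu : Fin n → ℤ} {k : Fin n} (hk : mu k < lam k) :
    skewDiagram lam mu =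
      insert (k, lam k) (skewDiagram (Function.update lam k (lam k - 1)) mu) := by
  ext ⟨i, j⟩
  simp only [Finset.mem_insert, mem_skewDiagram, Prod.mk.injEq]
  by_cases hi : i = k
  · subst hi
    simp only [Function.update_self, true_and]
    omega
  · simp [hi]

theorem notMem_skewDiagram_update {lam mu : Fin n → ℤ} {k : Fin n} :
    (k, lam k) ∉ skewDiagram (Function.update lam k (lam k - 1)) mu := by
  simp [mem_skewDiagram]

/-- The restored corner holds the maximum allowed in its row, so the row rule is free. The box above
it is at most a strictly smaller flag (`hpk`), and no box lies below it (`hnext`). -/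
theorem IsFlaggedFilling.update_last {L : ℤ} {p lam mu : Fin n → ℤ} {k : Fin n}
    (hlam : Antitone lam) (hL : L < p k) (hk : mu k < lam k) (hpk : ∀ j < k, p j < p k)
    (hnext : ∀ j : Fin n, (k : ℕ) + 1 = j → lam j < lam k) {g : Fin n × ℤ → ℤ}
    (hg : IsFlaggedFilling L p (Function.update lam k (lam k - 1)) mu g) :
    IsFlaggedFilling L p lam mu (Function.update g (k, lam k) (p k)) := by
  have hne : ∀ i j, (i = k → j ≠ lam k) → Function.update g (k, lam k) (p k) (i, j) = g (i, j) :=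
    fun i j hij => Function.update_of_ne (by rintro h; cases h; exact hij rfl rfl) _ _
  have hbox : ∀ i j, (i = k → j ≠ lam k) → j ≤ lam i →
      j ≤ Function.update lam k (lam k - 1) i := by
    intro i j hij hj
    by_cases hi : i = k
    · subst hi
      have := hij rfl
      simp only [Function.update_self]
      omega
    · simpa [hi] using hj
  have hle : ∀ i, Function.update lam k (lam k - 1) i ≤ lam i := by
    intro i
    by_cases hi : i = k
    · subst hi
      simp
    · simp [hi]
  refine ⟨fun i j hij => ?_, fun i j h1 h2 => ?_, fun i j h1 h2 => ?_, fun i j h1 h2 => ?_,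
    fun i i' j hii h1 h2 => ?_⟩
  · rw [hne i j (by rintro rfl rfl; exact hij ⟨hk, le_rfl⟩)]
    exact hg.off i j fun h => hij ⟨h.1, h.2.trans (hle i)⟩
  · by_cases hij : i = k → j ≠ lam k
    · rw [hne i j hij]
      exact hg.lower i j h1 (hbox i j hij h2)
    · push Not at hij
      obtain ⟨rfl, rfl⟩ := hij
      simpa using hL
  · by_cases hij : i = k → j ≠ lam k
    · rw [hne i j hij]
      exact hg.flag i j h1 (hbox i j hij h2)
    · push Not at hij
      obtain ⟨rfl, rfl⟩ := hij
      simp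
  · have hij0 : i = k → j ≠ lam k := by
      rintro rfl rfl
      omega
    rw [hne i j hij0]
    by_cases hij : i = k → j + 1 ≠ lam k
    · rw [hne i _ hij]
      exact hg.row i j h1 (hbox i _ hij h2)
    · push Not at hij
      obtain ⟨rfl, hj⟩ := hij
      rw [hj, Function.update_self]
      exact hg.flag i j h1 (hbox i j hij0 (by omega))
  · have hij0 : i = k → j ≠ lam k := by
      rintro rfl rfl
      have := hnext i' hii
      omega
    rw [hne i j hij0]
    by_cases hij : i' = k → j ≠ lam k
    · rw [hne i' _ hij]
      exact hg.col i i' j hii h1 (hbox i' _ hij h2)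
    · push Not at hij
      obtain ⟨rfl, rfl⟩ := hij
      rw [Function.update_self]
      have hi : i < i' := Fin.lt_def.2 (by omega)
      have h3 : lam i' ≤ Function.update lam i' (lam i' - 1) i := by
        simpa [hi.ne] using hlam hi.le
      exact (hg.flag i _ h1 h3).trans_lt (hpk i hi)

theorem IsFlaggedFilling.erase_last {L : ℤ} {p lam mu : Fin n → ℤ} {k : Fin n}
    (hk : mu k < lam k) {g : Fin n × ℤ → ℤ} (hg : IsFlaggedFilling L p lam mu g)
    (hnext : ∀ j : Fin n, (k : ℕ) + 1 = j → lam j < lam k) :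
    IsFlaggedFilling L p (Function.update lam k (lam k - 1)) mu
      (Function.update g (k, lam k) 0) := by
  have hne : ∀ i j, j ≤ Function.update lam k (lam k - 1) i →
      j ≤ lam i ∧ Function.update g (k, lam k) 0 (i, j) = g (i, j) := by
    intro i j hj
    by_cases hi : i = k
    · subst hi
      simp only [Function.update_self] at hj
      exact ⟨by omega, Function.update_of_ne (by simp; omega) _ _⟩
    · exact ⟨by simpa [hi] using hj, Function.update_of_ne (by simp [hi]) _ _⟩
  refine ⟨fun i j hij => ?_, fun i j h1 h2 => ?_, fun i j h1 h2 => ?_, fun i j h1 h2 => ?_,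
    fun i i' j hii h1 h2 => ?_⟩
  · by_cases h : (i, j) = (k, lam k)
    · rw [h, Function.update_self]
    · rw [Function.update_of_ne h]
      refine hg.off i j fun h' => hij ⟨h'.1, ?_⟩
      by_cases hi : i = k
      · subst hi
        have : j ≠ lam i := by simpa using h
        simp only [Function.update_self]
        omega
      · simpa [hi] using h'.2
  · rw [(hne i j h2).2]
    exact hg.lower i j h1 (hne i j h2).1
  · rw [(hne i j h2).2]
    exact hg.flag i j h1 (hne i j h2).1
  · rw [(hne i _ h2).2, (hne i j (by omega)).2]
    exact hg.row i j h1 (hne i _ h2).1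
  · rw [(hne i' j h2).2, Function.update_of_ne]
    · exact hg.col i i' j hii h1 (hne i' j h2).1
    · intro h
      cases h
      have := hnext i' hii
      have := (hne i' _ h2).1
      omega

theorem flaggedSum_eq_of_row_empty (w : ℤ → ℤ → R) (L t : ℤ) {p lam mu : Fin n → ℤ} {k : Fin n}
    (h : ∀ g, IsFlaggedFilling L p lam mu g → mu k < lam k → g (k, lam k) < p k) :
    flaggedSum w L t p lam mu = flaggedSum w L t (Function.update p k (p k - 1)) lam mu := by
  unfold flaggedSum
  rw [← filter_flaggedFillings_lt, Finset.filter_true_of_mem]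
  exact fun g hg => h g (mem_flaggedFillings.1 hg)

/-- Fillings split by whether the corner of row k is below p k or equal to it; in the second case
the corner is removed and contributes the factor `w`. -/
theorem flaggedSum_row (w : ℤ → ℤ → R) {L : ℤ} (t : ℤ) {p lam mu : Fin n → ℤ} {k : Fin n}
    (hlam : Antitone lam) (hL : L < p k) (hk : mu k < lam k) (hpk : ∀ j < k, p j < p k)
    (hnext : ∀ j : Fin n, (k : ℕ) + 1 = j → lam j < lam k) :
    flaggedSum w L t p lam mu = flaggedSum w L t (Function.update p k (p k - 1)) lam mu +
      w (p k) (content t (k, lam k)) *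
        flaggedSum w L t p (Function.update lam k (lam k - 1)) mu := by
  unfold flaggedSum
  rw [← filter_flaggedFillings_lt, ← Finset.sum_filter_add_sum_filter_not
    (flaggedFillings L p lam mu) (fun g => mu k < lam k → g (k, lam k) < p k), Finset.mul_sum]
  congr 1
  refine Finset.sum_bij' (fun g _ => Function.update g (k, lam k) 0)
    (fun g _ => Function.update g (k, lam k) (p k)) ?_ ?_ ?_ ?_ ?_
  · intro g hg
    rw [Finset.mem_filter, mem_flaggedFillings] at hg
    exact mem_flaggedFillings.2 (hg.1.erase_last hk hnext)
  · intro g hg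
    rw [mem_flaggedFillings] at hg
    rw [Finset.mem_filter, mem_flaggedFillings]
    exact ⟨hg.update_last hlam hL hk hpk hnext, by simp [hk]⟩
  · intro g hg
    rw [Finset.mem_filter, mem_flaggedFillings] at hg
    push Not at hg
    have := hg.1.flag k (lam k) hk le_rfl
    have h : p k = g (k, lam k) := by omega
    simp [h]
  · intro g hg
    rw [mem_flaggedFillings] at hg
    -- The removed corner already carries the default value 0, so erasing undoes inserting.
    have := hg.off k (lam k) (by simp)
    simp [← this]
  · intro g hg
    rw [Finset.mem_filter, mem_flaggedFillings] at hg
    push Not at hg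
    have := hg.1.flag k (lam k) hk le_rfl
    have h : g (k, lam k) = p k := by omega
    rw [skewDiagram_eq_insert hk, Finset.prod_insert notMem_skewDiagram_update, h]
    congr 1
    refine Finset.prod_congr rfl fun b hb => ?_
    rw [Function.update_of_ne]
    rintro rfl
    exact notMem_skewDiagram_update hb

theorem antitone_update_sub_one {lam : Fin n → ℤ} {k : Fin n} (hlam : Antitone lam)
    (hnext : ∀ j : Fin n, (k : ℕ) + 1 = j → lam j < lam k) :
    Antitone (Function.update lam k (lam k - 1)) := by
  intro i j hij
  rcases eq_or_ne i k with rfl | hi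
  · rcases eq_or_ne j i with rfl | hj
    · exact le_rfl
    · have hlt : (i : ℕ) < j := Fin.lt_def.1 (lt_of_le_of_ne hij hj.symm)
      have h1 := hnext ⟨i + 1, by omega⟩ rfl
      have h2 : lam j ≤ lam ⟨i + 1, by omega⟩ := hlam (Fin.le_def.2 (by simp; omega))
      simp only [Function.update_self, Function.update_of_ne hj]
      omega
  · rcases eq_or_ne j k with rfl | hj
    · have := hlam hij
      simp only [Function.update_self, Function.update_of_ne hi]
      omega
    · simpa [hi, hj] using hlam hij

theorem monotone_update_sub_one {p : Fin n → ℤ} {k : Fin n} (hp : Monotone p)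
    (hpk : ∀ j < k, p j < p k) : Monotone (Function.update p k (p k - 1)) := by
  intro i j hij
  rcases eq_or_ne j k with rfl | hj
  · rcases eq_or_ne i j with rfl | hi
    · exact le_rfl
    · have := hpk i (lt_of_le_of_ne hij hi)
      simp only [Function.update_self, Function.update_of_ne hi]
      omega
  · rcases eq_or_ne i k with rfl | hi
    · have := hp hij
      simp only [Function.update_self, Function.update_of_ne hj]
      omega
    · simpa [hi, hj] using hp hij

/-- The first index at which a monotone family reaches its largest value. -/
theorem exists_first_max {p : Fin n → ℤ} (hp : Monotone p) (i₀ : Fin n) :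
    ∃ k, p i₀ ≤ p k ∧ (∀ j < k, p j < p k) ∧ ∀ j, k ≤ j → p j = p k := by
  classical
  have : NeZero n := ⟨by have := i₀.2; omega⟩
  obtain ⟨m, -, hm⟩ := Finset.exists_max_image Finset.univ p ⟨i₀, Finset.mem_univ _⟩
  have hne : (Finset.univ.filter fun j => p j = p m).Nonempty := ⟨m, by simp⟩
  obtain ⟨k, hk, hmin⟩ := Finset.exists_min_image _ (fun j : Fin n => j) hne
  simp only [Finset.mem_filter, Finset.mem_univ, true_and, true_imp_iff] at hk hmin hm
  refine ⟨k, hk ▸ hm i₀, fun j hj => ?_, fun j hj => ?_⟩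
  · rw [hk]
    exact lt_of_le_of_ne (hm j) fun h => absurd (hmin j h) (not_le.2 hj)
  · exact le_antisymm (hk ▸ hm j) (hp hj)

theorem flaggedSum_lowest (w : ℤ → ℤ → R) (L t : ℤ) {p lam mu : Fin n → ℤ}
    (hlam : Antitone lam) (hle : ∀ i, mu i ≤ lam i) (hpL : ∀ i, p i = L) :
    flaggedSum w L t p lam mu = if lam = mu then 1 else 0 := by
  split_ifs with h
  · subst h
    have h1 : flaggedFillings L p lam lam = {0} := by
      ext g
      rw [mem_flaggedFillings, Finset.mem_singleton]
      constructor
      · intro hg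
        funext ⟨i, j⟩
        exact hg.off i j (by omega)
      · rintro rfl
        exact ⟨fun _ _ _ => rfl, fun _ _ _ _ => by omega, fun _ _ _ _ => by omega,
          fun _ _ _ _ => by omega, fun i i' j _ h1 h2 => by
            have := hlam (Fin.le_def.2 (by omega) : i ≤ i')
            omega⟩
    have h2 : skewDiagram lam lam = ∅ := by
      ext ⟨i, j⟩
      simp [mem_skewDiagram]
    simp [flaggedSum, h1, h2]
  · obtain ⟨i, hi⟩ := Function.ne_iff.1 h
    refine Finset.sum_eq_zero fun g hg => ?_
    rw [mem_flaggedFillings] at hg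
    have hi' := lt_of_le_of_ne (hle i) (Ne.symm hi)
    have h1 := hg.lower i _ hi' le_rfl
    have h2 := hg.flag i _ hi' le_rfl
    rw [hpL] at h2
    omega

theorem content_lt_content {t : ℤ} {lam : Fin n → ℤ} (hlam : Antitone lam) {i j : Fin n}
    (hij : i < j) : content t (j, lam j) < content t (i, lam i) := by
  have := hlam hij.le
  have := Fin.lt_def.1 hij
  simp only [content]
  omega

/-- Contents at row ends strictly decrease, so for an empty shape the matrix is the identity;
otherwise the first nonempty row gives a zero row. -/
theorem det_contentMatrix_lowest {h : ℤ → ℤ → ℤ → R} {L C t : ℤ} {p lam mu : Fin n → ℤ}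
    (hbase : ∀ c ≤ C, ∀ s, h L c s = if c = s then 1 else 0)
    (hlam : Antitone lam) (hmu : Antitone mu) (hle : ∀ i, mu i ≤ lam i) (hpL : ∀ i, p i = L)
    (hC : ∀ i, content t (i, lam i) ≤ C) :
    (contentMatrix h t p lam mu).det = if lam = mu then 1 else 0 := by
  split_ifs with heq
  · subst heq
    have : contentMatrix h t p lam lam = 1 := by
      ext i j
      simp only [contentMatrix, Matrix.of_apply, hpL, hbase _ (hC i), Matrix.one_apply]
      refine if_congr ⟨fun hij => ?_, fun hij => by rw [hij]⟩ rfl rfl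
      rcases lt_trichotomy i j with hlt | rfl | hlt
      · exact absurd hij (content_lt_content hlam hlt).ne'
      · rfl
      · exact absurd hij (content_lt_content hlam hlt).ne
    rw [this, Matrix.det_one]
  · have hne : (Finset.univ.filter fun i => lam i ≠ mu i).Nonempty := by
      obtain ⟨i, hi⟩ := Function.ne_iff.1 heq
      exact ⟨i, by simpa using hi⟩
    obtain ⟨k, hk, hmin⟩ := Finset.exists_min_image _ (fun j : Fin n => j) hne
    simp only [Finset.mem_filter, Finset.mem_univ, true_and] at hk hmin
    have hlt := lt_of_le_of_ne (hle k) (Ne.symm hk)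
    refine Matrix.det_eq_zero_of_row_eq_zero k fun l => ?_
    simp only [contentMatrix, Matrix.of_apply, hpL, hbase _ (hC k)]
    refine if_neg (lt_or_lt_iff_ne.1 ?_)
    have hkc : content t (k, mu k) < content t (k, lam k) := by
      simp only [content]
      omega
    -- Rows from k on start at a smaller content than row k ends; earlier rows are empty and start
    -- at a larger one.
    rcases lt_trichotomy k l with hkl | rfl | hkl
    · exact Or.inr ((content_lt_content hmu hkl).trans hkc)
    · exact Or.inr hkc
    · have : lam l = mu l := by
        by_contra hne'
        exact absurd (hmin l hne') (not_le.2 hkl)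
      rw [← this]
      exact Or.inl (content_lt_content hlam hkl)

/-- A flagged Jacobi--Trudi identity for weights depending on the content. -/
theorem det_contentMatrix_eq_flaggedSum {w : ℤ → ℤ → R} {h : ℤ → ℤ → ℤ → R} {L C : ℤ} (t : ℤ)
    (hrec : ∀ P c s, h P c s = h (P - 1) c s + w P c * h P (c - 1) s)
    (hbase : ∀ c ≤ C, ∀ s, h L c s = if c = s then 1 else 0)
    (hneg : ∀ P c s, c < s → h P c s = 0) {p lam mu : Fin n → ℤ}
    (hp : Monotone p) (hlam : Antitone lam) (hmu : Antitone mu)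
    (hle : ∀ i, mu i ≤ lam i) (hpL : ∀ i, L ≤ p i) (hC : ∀ i, content t (i, lam i) ≤ C) :
    (contentMatrix h t p lam mu).det = flaggedSum w L t p lam mu := by
  obtain ⟨N, hN⟩ : ∃ N : ℕ, ∑ i, p i + ∑ i, lam i < ∑ i : Fin n, L + ∑ i, mu i + N :=
    -- N strictly bounds the total excess of p over L and of lam over mu; each recursive call lowers
    -- that excess by one.
    ⟨(∑ i, p i + ∑ i, lam i - (∑ i : Fin n, L + ∑ i, mu i)).toNat + 1, by omega⟩
  induction N generalizing p lam with
  | zero =>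
    have h1 : ∑ i : Fin n, L ≤ ∑ i, p i := Finset.sum_le_sum fun i _ => hpL i
    have h2 : ∑ i, mu i ≤ ∑ i, lam i := Finset.sum_le_sum fun i _ => hle i
    omega
  | succ N ih =>
    by_cases hall : ∀ i, p i = L
    · rw [det_contentMatrix_lowest hbase hlam hmu hle hall hC,
        flaggedSum_lowest w L t hlam hle hall]
    push Not at hall
    obtain ⟨i₀, hi₀⟩ := hall
    obtain ⟨k, hik, hpk, hkp⟩ := exists_first_max hp i₀
    have hL : L < p k := (lt_of_le_of_ne (hpL i₀) hi₀.symm).trans_le hik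
    have hsum : ∀ f : Fin n → ℤ, ∑ i, Function.update f k (f k - 1) i = ∑ i, f i - 1 := by
      intro f
      rw [Finset.sum_update_of_mem (Finset.mem_univ k),
        ← Finset.add_sum_erase _ f (Finset.mem_univ k), Finset.sdiff_singleton_eq_erase]
      ring
    have hfst := ih (p := Function.update p k (p k - 1)) (lam := lam)
      (monotone_update_sub_one hp hpk) hlam hle
      (fun i => by
        rcases eq_or_ne i k with rfl | hi
        · simp only [Function.update_self]
          omega
        · simpa [hi] using hpL i) hC
      (by rw [hsum]; push_cast at hN; omega)
    rw [det_contentMatrix_row hrec t p lam mu k, hfst]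
    rcases (hle k).eq_or_lt with hempty | hlt
    · rw [flaggedSum_eq_of_row_empty w L t (p := p) (k := k) fun g _ h => by omega,
        -- After shortening the empty row k, every row from k on ends before any row up to k starts,
        -- which makes a zero block.
        Matrix.det_eq_zero_of_block _ k, mul_zero, add_zero]
      intro i j hi hj
      simp only [contentMatrix, Matrix.of_apply]
      refine hneg _ _ _ ?_
      have h1 := hmu hj
      have h2 := Fin.le_def.1 hj
      have h3 := Fin.le_def.1 hi
      rcases eq_or_ne i k with rfl | hik
      · simp only [Function.update_self, content]
        omega
      · have h4 := hlam hi
        have h5 : (i : ℕ) ≠ k := fun h => hik (Fin.ext h)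
        simp only [Function.update_of_ne hik, content]
        omega
    by_cases hnext : ∀ j : Fin n, (k : ℕ) + 1 = j → lam j < lam k
    · have hle' : ∀ i, Function.update lam k (lam k - 1) i ≤ lam i := by
        intro i
        rcases eq_or_ne i k with rfl | hi
        · simp
        · simp [hi]
      rw [flaggedSum_row w t hlam hL hlt hpk hnext,
        ih hp (antitone_update_sub_one hlam hnext) _ hpL _ _]
      · intro i
        rcases eq_or_ne i k with rfl | hi
        · simp only [Function.update_self]
          omega
        · simpa [hi] using hle i
      · intro i
        have h1 := hC i
        have h2 := hle' i
        simp only [content] at h1 ⊢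
        omega
      · rw [hsum]
        push_cast at hN
        omega
    · push Not at hnext
      obtain ⟨j, hkj, hj⟩ := hnext
      have hkj' : k < j := Fin.lt_def.2 (by omega)
      have heq : lam j = lam k := le_antisymm (hlam hkj'.le) hj
      -- Shortened row k and row k + 1 have equal flags and equal end contents, hence equal matrix
      -- rows. An entry p k above row k + 1 would violate column strictness.
      rw [flaggedSum_eq_of_row_empty w L t (p := p) (k := k), Matrix.det_zero_of_row_eq hkj'.ne,
        mul_zero, add_zero]
      · funext l
        simp only [contentMatrix, Matrix.of_apply, Function.update_self,
          Function.update_of_ne hkj'.ne', hkp j hkj'.le]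
        congr 1
        simp only [content]
        omega
      · intro g hg _
        have h1 := hg.col k j (lam k) hkj hlt hj
        have h2 := hg.flag j (lam k) ((hmu hkj'.le).trans_lt hlt) hj
        rw [hkp j hkj'.le] at h2
        omega

end Determinant

/-! ### Row generating functions -/

section Series

variable {R : Type*} [CommRing R]

/-- Extension by zero of a family of variables from the positive integers to all integers. -/
def extendZero (x : ℕ → R) (k : ℤ) : R := if 1 ≤ k then x k.toNat else 0

theorem extendZero_natCast (x : ℕ → R) {k : ℕ} (hk : 1 ≤ k) : extendZero x (k : ℤ) = x k := by
  simp [extendZero, hk]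

theorem extendZero_of_nonpos (x : ℕ → R) {k : ℤ} (hk : k ≤ 0) : extendZero x k = 0 :=
  if_neg (by omega)

/-- The quotient `chernSeries` is determined by `chernSeries_mul`. -/
theorem chernSeries_unique {x y : ℕ → R} {p q : ℕ} {f : PowerSeries R}
    (hf : f * (∏ a ∈ Finset.Icc 1 p, (1 - PowerSeries.C (x a) * PowerSeries.X)) =
      ∏ b ∈ Finset.Icc 1 q, (1 + PowerSeries.C (y b) * PowerSeries.X)) :
    f = chernSeries x y p q := by
  have hu : (∏ a ∈ Finset.Icc 1 p, (1 - PowerSeries.C (x a) * PowerSeries.X)) *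
      PowerSeries.invOfUnit
        (∏ a ∈ Finset.Icc 1 p, (1 - PowerSeries.C (x a) * PowerSeries.X)) 1 = 1 :=
    PowerSeries.mul_invOfUnit _ _ (by simp [map_prod])
  rw [chernSeries, ← hf, mul_assoc, hu, mul_one]

theorem chernSeries_zero_zero (x y : ℕ → R) : chernSeries x y 0 0 = 1 :=
  (chernSeries_unique (by simp)).symm

theorem chernSeries_succ_right (x y : ℕ → R) (p q : ℕ) :
    chernSeries x y p (q + 1) =
      chernSeries x y p q * (1 + PowerSeries.C (y (q + 1)) * PowerSeries.X) := by
  refine (chernSeries_unique ?_).symm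
  rw [mul_right_comm, chernSeries_mul, Finset.prod_Icc_succ_top (by omega)]

theorem chernSeries_succ_left (x y : ℕ → R) (p q : ℕ) :
    chernSeries x y (p + 1) q * (1 - PowerSeries.C (x (p + 1)) * PowerSeries.X) =
      chernSeries x y p q := by
  refine chernSeries_unique ?_
  rw [← chernSeries_mul x y (p + 1) q, Finset.prod_Icc_succ_top (by omega)]
  ring

theorem chernSeries_toNat_right (x y : ℕ → R) (p : ℕ) (Q : ℤ) :
    chernSeries x y p Q.toNat = chernSeries x y p (Q - 1).toNat *
      (1 + PowerSeries.C (extendZero y Q) * PowerSeries.X) := by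
  rcases le_or_gt Q 0 with hQ | hQ
  · rw [extendZero_of_nonpos y hQ, Int.toNat_of_nonpos hQ, Int.toNat_of_nonpos (by omega)]
    simp
  · obtain ⟨q, rfl⟩ : ∃ q : ℕ, Q = ((q + 1 : ℕ) : ℤ) := ⟨(Q - 1).toNat, by omega⟩
    rw [extendZero_natCast y (by omega), Int.toNat_natCast, chernSeries_succ_right]
    simp

theorem chernSeries_toNat_left (x y : ℕ → R) (P : ℤ) (q : ℕ) :
    chernSeries x y P.toNat q * (1 - PowerSeries.C (extendZero x P) * PowerSeries.X) =
      chernSeries x y (P - 1).toNat q := by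
  rcases le_or_gt P 0 with hP | hP
  · rw [extendZero_of_nonpos x hP, Int.toNat_of_nonpos hP, Int.toNat_of_nonpos (by omega)]
    simp
  · obtain ⟨p, rfl⟩ : ∃ p : ℕ, P = ((p + 1 : ℕ) : ℤ) := ⟨(P - 1).toNat, by omega⟩
    rw [extendZero_natCast x (by omega), Int.toNat_natCast, chernSeries_succ_left]
    simp

/-- With F the series for (P, Q - 1), this is F(1 + yT) = F(1 - xT) + (x + y)TF. Zero extension
makes it hold for all integers P and Q. -/
theorem chernSeries_toNat_rec (x y : ℕ → R) (P Q : ℤ) :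
    chernSeries x y P.toNat Q.toNat = chernSeries x y (P - 1).toNat (Q - 1).toNat +
      PowerSeries.C (extendZero x P + extendZero y Q) *
        (chernSeries x y P.toNat (Q - 1).toNat * PowerSeries.X) := by
  rw [chernSeries_toNat_right, ← chernSeries_toNat_left x y P, map_add]
  ring

theorem coeffInt_of_neg (f : PowerSeries R) {m : ℤ} (hm : m < 0) : coeffInt f m = 0 :=
  if_neg (by omega)

theorem coeffInt_add (f g : PowerSeries R) (m : ℤ) :
    coeffInt (f + g) m = coeffInt f m + coeffInt g m := by
  unfold coeffInt
  split_ifs <;> simp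

theorem coeffInt_C_mul_mul_X (a : R) (f : PowerSeries R) (m : ℤ) :
    coeffInt (PowerSeries.C a * (f * PowerSeries.X)) m = a * coeffInt f (m - 1) := by
  rcases lt_trichotomy m 0 with hm | rfl | hm
  · rw [coeffInt_of_neg _ hm, coeffInt_of_neg _ (by omega), mul_zero]
  · simp [coeffInt]
  · obtain ⟨k, rfl⟩ : ∃ k : ℕ, m = ((k + 1 : ℕ) : ℤ) := ⟨(m - 1).toNat, by omega⟩
    have h : ((k + 1 : ℕ) : ℤ) - 1 = k := by push_cast; ring
    rw [h, coeffInt, coeffInt, if_pos (by omega), if_pos (by omega), Int.toNat_natCast,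
      Int.toNat_natCast, PowerSeries.coeff_C_mul, PowerSeries.coeff_succ_mul_X]

theorem coeffInt_one (m : ℤ) : coeffInt (1 : PowerSeries R) m = if m = 0 then 1 else 0 := by
  unfold coeffInt
  rw [PowerSeries.coeff_one]
  split_ifs <;> first | rfl | omega

/-- The generating function of one row ending at content `c`, starting after content `s`,
with entries at most `P`. -/
noncomputable def rowCoeff (x y : ℕ → R) (P c s : ℤ) : R :=
  coeffInt (chernSeries x y P.toNat (P + c).toNat) (c - s)

theorem rowCoeff_rec (x y : ℕ → R) (P c s : ℤ) :
    rowCoeff x y P c s = rowCoeff x y (P - 1) c s +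
      (extendZero x P + extendZero y (P + c)) * rowCoeff x y P (c - 1) s := by
  unfold rowCoeff
  rw [chernSeries_toNat_rec, coeffInt_add, coeffInt_C_mul_mul_X]
  rw [show P + c - 1 = P - 1 + c by ring, show P + (c - 1) = P - 1 + c by ring,
    show c - 1 - s = c - s - 1 by ring]

theorem rowCoeff_of_lt (x y : ℕ → R) {P c s : ℤ} (h : c < s) : rowCoeff x y P c s = 0 :=
  coeffInt_of_neg _ (by omega)

theorem rowCoeff_low (x y : ℕ → R) {P c s : ℤ} (hP : P ≤ 0) (hPc : P + c ≤ 0) :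
    rowCoeff x y P c s = if c = s then 1 else 0 := by
  rw [rowCoeff, Int.toNat_of_nonpos hP, Int.toNat_of_nonpos hPc, chernSeries_zero_zero,
    coeffInt_one]
  exact if_congr sub_eq_zero rfl rfl

end Series

/-! ### Encoding an entry by an integer -/

namespace TabEntry

/-- The entry of a box of content `c` encoded by the integer `g`: its plain part is `g` and its
primed part is `g + c`, as far as these are positive. -/
def ofIndex (c g : ℤ) : TabEntry :=
  if g ≤ 0 then primed (g + c).toNat
  else if g + c ≤ 0 then plain g.toNat
  else pair g.toNat (g + c).toNat

/-- The integer encoding an entry of a box of content `c`. -/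
def index (c : ℤ) : TabEntry → ℤ
  | plain k => k
  | primed l => l - c
  | pair k _ => k

/-- All integers occurring in the entry are positive. -/
def Positive (e : TabEntry) : Prop :=
  (∀ k ∈ e.plainPart, 1 ≤ k) ∧ ∀ l ∈ e.primedPart, 1 ≤ l

theorem mem_plainPart_ofIndex {c g : ℤ} {k : ℕ} :
    k ∈ (ofIndex c g).plainPart ↔ 0 < g ∧ (k : ℤ) = g := by
  unfold ofIndex
  split_ifs <;> simp [plainPart] <;> omega

theorem mem_primedPart_ofIndex {c g : ℤ} {l : ℕ} (h : 0 < g ∨ 0 < g + c) :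
    l ∈ (ofIndex c g).primedPart ↔ 0 < g + c ∧ (l : ℤ) = g + c := by
  unfold ofIndex
  split_ifs <;> simp [primedPart] <;> omega

theorem isSome_plainPart_ofIndex {c g : ℤ} : (ofIndex c g).plainPart.isSome ↔ 0 < g := by
  unfold ofIndex
  split_ifs <;> simp [plainPart] <;> omega

theorem isSome_primedPart_ofIndex {c g : ℤ} (h : 0 < g ∨ 0 < g + c) :
    (ofIndex c g).primedPart.isSome ↔ 0 < g + c := by
  unfold ofIndex
  split_ifs <;> simp [primedPart] <;> omega

theorem fitsContent_ofIndex {c g : ℤ} (h : 0 < g ∨ 0 < g + c) : (ofIndex c g).FitsContent c := by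
  unfold ofIndex
  split_ifs <;> simp only [FitsContent] <;> omega

theorem ofIndex_eq_pair {c g : ℤ} {k l : ℕ} :
    ofIndex c g = pair k l ↔ 0 < g ∧ 0 < g + c ∧ (k : ℤ) = g ∧ (l : ℤ) = g + c := by
  unfold ofIndex
  split_ifs <;> simp <;> omega

theorem index_ofIndex {c g : ℤ} (h : 0 < g ∨ 0 < g + c) : (ofIndex c g).index c = g := by
  unfold ofIndex
  split_ifs <;> simp only [index] <;> omega

/-- The content conditions on a lone plain or primed entry say exactly that the missing part would
be nonpositive. -/
theorem ofIndex_index {c : ℤ} {e : TabEntry} (hpos : e.Positive) (hfit : e.FitsContent c) :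
    ofIndex c (e.index c) = e := by
  obtain ⟨h1, h2⟩ := hpos
  cases e with
  | plain k =>
    have := h1 k rfl
    simp only [FitsContent] at hfit
    rw [ofIndex, index, if_neg (by omega), if_pos (by omega), Int.toNat_natCast]
  | primed l =>
    have := h2 l rfl
    simp only [FitsContent] at hfit
    rw [ofIndex, index, if_pos (by omega), sub_add_cancel, Int.toNat_natCast]
  | pair k l =>
    have := h1 k rfl
    have := h2 l rfl
    simp only [FitsContent] at hfit
    rw [ofIndex, index, if_neg (by omega), if_neg (by omega), Int.toNat_natCast,
      show (k : ℤ) + c = l by omega, Int.toNat_natCast]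

theorem index_pos {c : ℤ} {e : TabEntry} (hpos : e.Positive) (hfit : e.FitsContent c) :
    0 < e.index c ∨ 0 < e.index c + c := by
  obtain ⟨h1, h2⟩ := hpos
  cases e with
  | plain k =>
    have := h1 k rfl
    simp only [index]
    omega
  | primed l =>
    have := h2 l rfl
    simp only [index]
    omega
  | pair k l =>
    have := h1 k rfl
    simp only [index]
    omega

theorem weight_ofIndex {R : Type*} [CommRing R] (x y : ℕ → R) {c g : ℤ} (h : 0 < g ∨ 0 < g + c) :
    (ofIndex c g).weight x y = extendZero x g + extendZero y (g + c) := by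
  unfold ofIndex
  split_ifs with h1 h2
  · rw [extendZero_of_nonpos x h1, zero_add, weight, extendZero, if_pos (by omega)]
  · rw [extendZero_of_nonpos y h2, add_zero, weight, extendZero, if_pos (by omega)]
  · rw [weight, extendZero, extendZero, if_pos (by omega), if_pos (by omega)]

end TabEntry


theorem IsTableau.positive {n : ℕ} {p q : Fin n → ℕ} {t : ℤ} {lam mu : Fin n → ℤ}
    {T : Filling lam mu} (hT : IsTableau p q t lam mu T) (b) : (T b).Positive :=
  ⟨fun k hk => (hT.plain_flag b k hk).1, fun l hl => (hT.primed_flag b l hl).1⟩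

/-! ### Tableaux as integer fillings -/

section Bijection

open TabEntry

variable {n : ℕ} {p q : Fin n → ℕ} {L t : ℤ} {lam mu : Fin n → ℤ}

/-- The filling by entries that is encoded by an integer filling. -/
def decodeFilling (t : ℤ) (lam mu : Fin n → ℤ) (g : Fin n × ℤ → ℤ) : Filling lam mu :=
  fun b => TabEntry.ofIndex (content t b.1) (g b.1)

/-- The integer filling that encodes a filling by entries. -/
noncomputable def encodeFilling (t : ℤ) {lam mu : Fin n → ℤ} (T : Filling lam mu) :
    Fin n × ℤ → ℤ :=
  open Classical in
  fun b => if hb : b ∈ skewDiagram lam mu then (T ⟨b, hb⟩).index (content t b) else 0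

theorem encodeFilling_apply (t : ℤ) (T : Filling lam mu) {b : Fin n × ℤ}
    (hb : b ∈ skewDiagram lam mu) :
    encodeFilling t T b = (T ⟨b, hb⟩).index (content t b) :=
  dif_pos hb

theorem IsFlaggedFilling.isTableau (hlam : Antitone lam) (hmu : Antitone mu)
    (hlast : ∀ i, content t (i, lam i) = (q i : ℤ) - p i) {g : Fin n × ℤ → ℤ}
    (hg : IsFlaggedFilling L (fun i => (p i : ℤ)) lam mu g)
    (hpos : ∀ b ∈ skewDiagram lam mu, 0 < g b ∨ 0 < g b + content t b) :
    IsTableau p q t lam mu (decodeFilling t lam mu g) := by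
  have hcont : ∀ i j, content t (i, j) = j - (((i : Fin n) : ℕ) + 1) - t := fun i j => rfl
  have hrow : ∀ b b' : {b : Fin n × ℤ // b ∈ skewDiagram lam mu}, b.1.1 = b'.1.1 →
      b.1.2 < b'.1.2 → g b.1 ≤ g b'.1 ∧
        -- The content gain makes g + c strictly increasing along rows. Down a column, the gain in g
        -- at least offsets the content loss.
        g b.1 + content t b.1 + (b'.1.2 - b.1.2) ≤ g b'.1 + content t b'.1 := by
    rintro ⟨⟨i, j⟩, hb⟩ ⟨⟨i', j'⟩, hb'⟩ h1 h2
    simp only at h1 h2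
    subst h1
    have : g (i, j) ≤ g (i, j') :=
      hg.row_le (mem_skewDiagram.1 hb).1 h2.le (mem_skewDiagram.1 hb').2
    simp only [hcont]
    omega
  have hcol : ∀ b b' : {b : Fin n × ℤ // b ∈ skewDiagram lam mu}, b.1.1 < b'.1.1 →
      b.1.2 = b'.1.2 → g b.1 < g b'.1 ∧ g b.1 + content t b.1 ≤ g b'.1 + content t b'.1 := by
    rintro ⟨⟨i, j⟩, hb⟩ ⟨⟨i', j'⟩, hb'⟩ h1 h2
    simp only at h1 h2
    subst h2
    have h3 : (i : ℕ) < i' := h1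
    have : g (i, j) + ((i' - i : ℕ) : ℤ) ≤ g (i', j) :=
      hg.col_add_le hlam hmu (mem_skewDiagram.1 hb).1 _ i'
        (Nat.add_sub_of_le h3.le).symm (mem_skewDiagram.1 hb').2
    simp only [hcont]
    omega
  constructor
  · intro b k hk
    have h1 := mem_plainPart_ofIndex.1 hk
    have hb := mem_skewDiagram.1 b.2
    have h2 : g b.1 ≤ p b.1.1 := hg.flag _ _ hb.1 hb.2
    omega
  · intro b l hl
    have h1 := (mem_primedPart_ofIndex (hpos _ b.2)).1 hl
    have hb := mem_skewDiagram.1 b.2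
    have h2 : g b.1 ≤ p b.1.1 := hg.flag _ _ hb.1 hb.2
    -- Primed flag: g + c is at most p plus the content of the last box of the row, which is q.
    have h3 := hlast b.1.1
    have h4 : content t b.1 = b.1.2 - (((b.1.1 : ℕ) : ℤ) + 1) - t := rfl
    simp only [hcont] at h3
    omega
  · exact fun b => fitsContent_ofIndex (hpos _ b.2)
  · intro b b' h1 h2
    have := hrow b b' h1 h2
    simp only [decodeFilling, isSome_plainPart_ofIndex]
    omega
  · intro b b' h1 h2
    have := hrow b b' h1 h2
    simp only [decodeFilling, isSome_primedPart_ofIndex (hpos _ b.2),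
      isSome_primedPart_ofIndex (hpos _ b'.2)]
    omega
  · intro b b' h1 h2
    have := hcol b b' h1 h2
    simp only [decodeFilling, isSome_plainPart_ofIndex]
    omega
  · intro b b' h1 h2
    have := hcol b b' h1 h2
    simp only [decodeFilling, isSome_primedPart_ofIndex (hpos _ b.2),
      isSome_primedPart_ofIndex (hpos _ b'.2)]
    omega
  · intro b b' h1 h2 k hk k' hk'
    have := hrow b b' h1 h2
    have := mem_plainPart_ofIndex.1 hk
    have := mem_plainPart_ofIndex.1 hk'
    omega
  · intro b b' h1 h2 k hk k' hk'
    have := hcol b b' h1 h2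
    have := mem_plainPart_ofIndex.1 hk
    have := mem_plainPart_ofIndex.1 hk'
    omega
  · intro b b' h1 h2 l hl l' hl'
    have := hrow b b' h1 h2
    have := (mem_primedPart_ofIndex (hpos _ b.2)).1 hl
    have := (mem_primedPart_ofIndex (hpos _ b'.2)).1 hl'
    omega
  · intro b b' h1 h2 l hl l' hl'
    have := hcol b b' h1 h2
    have := (mem_primedPart_ofIndex (hpos _ b.2)).1 hl
    have := (mem_primedPart_ofIndex (hpos _ b'.2)).1 hl'
    omega
  · intro b b' h1 h2 k l hkl
    have h3 := hrow b b' h1 (by omega)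
    have h4 := ofIndex_eq_pair.1 hkl
    have h5 : content t b'.1 = content t b.1 + 1 := by
      simp only [content, h1]
      omega
    refine ⟨(g b'.1 - g b.1).toNat, ofIndex_eq_pair.2 ?_⟩
    push_cast
    omega
  · intro b b' h1 h2 k l hkl
    have h3 := hcol b b' (Fin.lt_def.2 (by omega)) h2
    have h4 := ofIndex_eq_pair.1 hkl
    have h5 : content t b'.1 = content t b.1 - 1 := by
      simp only [content]
      omega
    refine ⟨(g b'.1 - g b.1 - 1).toNat, ofIndex_eq_pair.2 ?_⟩
    push_cast
    omega

/-- Persistence of parts to the right and below excludes a loss of either part. A lone primed entry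
has nonpositive index, hence precedes any plain part; the other cases are the order rules. -/
theorem IsTableau.isFlaggedFilling (hlam : Antitone lam) (hmu : Antitone mu)
    (hL : ∀ i, content t (i, lam i) ≤ -L) (hL0 : L ≤ 0) {T : Filling lam mu}
    (hT : IsTableau p q t lam mu T) :
    IsFlaggedFilling L (fun i => (p i : ℤ)) lam mu (encodeFilling t T) := by
  have hcont : ∀ i j, content t (i, j) = j - (((i : Fin n) : ℕ) + 1) - t := fun i j => rfl
  refine ⟨fun i j hij => dif_neg (by rwa [mem_skewDiagram]), fun i j h1 h2 => ?_,
    fun i j h1 h2 => ?_, fun i j h1 h2 => ?_, fun i i' j hii h1 h2 => ?_⟩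
  · have hb : (i, j) ∈ skewDiagram lam mu := mem_skewDiagram.2 ⟨h1, h2⟩
    rw [encodeFilling_apply t T hb]
    have h3 := index_pos (hT.positive ⟨_, hb⟩) (hT.fits ⟨_, hb⟩)
    have h4 := hL i
    simp only [hcont] at h3 h4 ⊢
    omega
  · have hb : (i, j) ∈ skewDiagram lam mu := mem_skewDiagram.2 ⟨h1, h2⟩
    rw [encodeFilling_apply t T hb]
    have h3 := hT.plain_flag ⟨_, hb⟩
    have h4 := hT.fits ⟨_, hb⟩
    cases hTb : T ⟨(i, j), hb⟩ with
    | plain k =>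
      have : 1 ≤ k ∧ k ≤ p i := h3 k (by rw [hTb]; rfl)
      simp only [index]
      omega
    | primed l =>
      simp only [hTb, FitsContent] at h4
      simp only [index]
      omega
    | pair k l =>
      have : 1 ≤ k ∧ k ≤ p i := h3 k (by rw [hTb]; rfl)
      simp only [index]
      omega
  · have hb : (i, j) ∈ skewDiagram lam mu := mem_skewDiagram.2 ⟨h1, (lt_add_one j).le.trans h2⟩
    have hb' : (i, j + 1) ∈ skewDiagram lam mu := mem_skewDiagram.2 ⟨h1.trans (lt_add_one j), h2⟩
    rw [encodeFilling_apply t T hb, encodeFilling_apply t T hb']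
    have hc : content t (i, j + 1) = content t (i, j) + 1 := by
      simp only [hcont]
      omega
    have f1 := hT.fits ⟨_, hb⟩
    have f2 := hT.fits ⟨_, hb'⟩
    have h3 := hT.plain_right ⟨_, hb⟩ ⟨_, hb'⟩ rfl (by simp)
    have h4 := hT.primed_right ⟨_, hb⟩ ⟨_, hb'⟩ rfl (by simp)
    have h5 := hT.plain_row ⟨_, hb⟩ ⟨_, hb'⟩ rfl (by simp)
    have h6 := hT.primed_row ⟨_, hb⟩ ⟨_, hb'⟩ rfl (by simp)
    simp only [hc] at f2 ⊢
    generalize T ⟨(i, j), hb⟩ = e at *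
    generalize T ⟨(i, j + 1), hb'⟩ = e' at *
    cases e <;> cases e' <;> simp [FitsContent, index, plainPart, primedPart] at * <;> omega
  · have hi : i ≤ i' := Fin.le_def.2 (by omega)
    have hi' : i < i' := Fin.lt_def.2 (by omega)
    have hb : (i, j) ∈ skewDiagram lam mu := mem_skewDiagram.2 ⟨h1, h2.trans (hlam hi)⟩
    have hb' : (i', j) ∈ skewDiagram lam mu := mem_skewDiagram.2 ⟨(hmu hi).trans_lt h1, h2⟩
    rw [encodeFilling_apply t T hb, encodeFilling_apply t T hb']
    have hc : content t (i', j) = content t (i, j) - 1 := by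
      simp only [hcont]
      omega
    have f1 := hT.fits ⟨_, hb⟩
    have f2 := hT.fits ⟨_, hb'⟩
    have h3 := hT.plain_below ⟨_, hb⟩ ⟨_, hb'⟩ hi' rfl
    have h4 := hT.primed_below ⟨_, hb⟩ ⟨_, hb'⟩ hi' rfl
    have h5 := hT.plain_col ⟨_, hb⟩ ⟨_, hb'⟩ hi' rfl
    have h6 := hT.primed_col ⟨_, hb⟩ ⟨_, hb'⟩ hi' rfl
    have h7 := (hT.positive ⟨_, hb⟩).1
    have h8 := (hT.positive ⟨_, hb'⟩).1
    simp only [hc] at f2 ⊢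
    generalize T ⟨(i, j), hb⟩ = e at *
    generalize T ⟨(i', j), hb'⟩ = e' at *
    cases e <;> cases e' <;> simp [FitsContent, index, plainPart, primedPart] at * <;> omega

theorem flaggedSum_eq_sum_tableaux {R : Type*} [CommRing R] (x y : ℕ → R)
    (hlam : Antitone lam) (hmu : Antitone mu)
    (hlast : ∀ i, content t (i, lam i) = (q i : ℤ) - p i)
    (hL : ∀ i, content t (i, lam i) ≤ -L) (hL0 : L ≤ 0) :
    flaggedSum (fun g c => extendZero x g + extendZero y (g + c)) L t (fun i => (p i : ℤ)) lam mu =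
      ∑ T ∈ tableaux p q t lam mu, fillingWeight x y T := by
  classical
  unfold flaggedSum
  -- A filling in which some box has both g and g + c nonpositive has weight zero.
  rw [← Finset.sum_filter_of_ne
    (p := fun g => ∀ b ∈ skewDiagram lam mu, 0 < g b ∨ 0 < g b + content t b)]
  · refine Finset.sum_bij' (fun g _ => decodeFilling t lam mu g) (fun T _ => encodeFilling t T)
      ?_ ?_ ?_ ?_ ?_
    · intro g hg
      rw [Finset.mem_filter, mem_flaggedFillings] at hg
      exact mem_tableaux.2 (hg.1.isTableau hlam hmu hlast hg.2)
    · intro T hT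
      rw [mem_tableaux] at hT
      rw [Finset.mem_filter, mem_flaggedFillings]
      refine ⟨hT.isFlaggedFilling hlam hmu hL hL0, fun b hb => ?_⟩
      rw [encodeFilling_apply t T hb]
      exact index_pos (hT.positive ⟨b, hb⟩) (hT.fits ⟨b, hb⟩)
    · intro g hg
      rw [Finset.mem_filter, mem_flaggedFillings] at hg
      funext b
      by_cases hb : b ∈ skewDiagram lam mu
      · rw [encodeFilling_apply t _ hb]
        exact index_ofIndex (hg.2 b hb)
      · rw [encodeFilling, dif_neg hb]
        exact (hg.1.off b.1 b.2 (by rwa [mem_skewDiagram] at hb)).symm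
    · intro T hT
      rw [mem_tableaux] at hT
      funext b
      rw [decodeFilling, encodeFilling_apply t T b.2]
      exact ofIndex_index (hT.positive b) (hT.fits b)
    · intro g hg
      rw [Finset.mem_filter, mem_flaggedFillings] at hg
      rw [fillingWeight, ← Finset.prod_coe_sort]
      exact Finset.prod_congr rfl fun b _ => (weight_ofIndex x y (hg.2 b.1 b.2)).symm
  · intro g _ hne b hb
    by_contra! h
    refine hne (Finset.prod_eq_zero hb ?_)
    simp only [extendZero_of_nonpos x h.1, extendZero_of_nonpos y h.2, add_zero]

end Bijection

/-! ### Specialization to the given series -/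

theorem mainTheorem4 {R : Type*} [CommRing R] (x y : ℕ → R) {n : ℕ} (p q : Fin n → ℕ)
    (hp : Monotone p) (hq : Antitone q)
    (hstrict : ∀ i j : Fin n, (i : ℕ) + 1 = (j : ℕ) → p i < p j ∨ q j < q i)
    (t : ℤ) (lam mu : Fin n → ℤ)
    (hlam : ∀ i : Fin n, lam i = (q i : ℤ) - (p i : ℤ) + (((i : ℕ) : ℤ) + 1) + t)
    (hmu : Antitone mu) (hle : ∀ i, mu i ≤ lam i) :
    schurDet (fun i => chernSeries x y (p i) (q i)) lam mu =
      ∑ T ∈ tableaux p q t lam mu, fillingWeight x y T := by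
  have hlast : ∀ i, content t (i, lam i) = (q i : ℤ) - p i := fun i => by
    simp only [content, hlam]
    ring
  have hanti : Antitone lam := by
    cases n with
    | zero => exact fun i => i.elim0
    | succ n =>
      refine Fin.antitone_iff_succ_le.2 fun i => ?_
      -- The total change in p and q is at least one, which absorbs the shift by the row index.
      have h1 := hstrict i.castSucc i.succ (by simp)
      have h2 := hp (Fin.castSucc_lt_succ (i := i)).le
      have h3 := hq (Fin.castSucc_lt_succ (i := i)).le
      rw [hlam, hlam]
      simp only [Fin.val_castSucc, Fin.val_succ]
      push_cast
      omega
  have hC : ∀ i, content t (i, lam i) ≤ ((∑ i, q i : ℕ) : ℤ) := fun i => by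
    have := Finset.single_le_sum (f := q) (fun _ _ => Nat.zero_le _) (Finset.mem_univ i)
    rw [hlast]
    omega
  -- The sum of all q bounds every content, so at flag L both products in a row series are empty.
  rw [← flaggedSum_eq_sum_tableaux (L := -((∑ i, q i : ℕ) : ℤ)) x y hanti hmu hlast
      (fun i => by rw [neg_neg]; exact hC i) (by omega),
    ← det_contentMatrix_eq_flaggedSum (h := rowCoeff x y) t (rowCoeff_rec x y)
      (fun c hc s => rowCoeff_low x y (by omega) (by omega)) (fun _ _ _ => rowCoeff_of_lt x y)
      (fun i j hij => Int.ofNat_le.2 (hp hij)) hanti hmu hle (fun i => by omega) hC, schurDet]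
  congr 1
  ext k l
  simp only [contentMatrix, Matrix.of_apply, rowCoeff, hlast]
  congr 1
  · rw [Int.toNat_natCast, add_sub_cancel, Int.toNat_natCast]
  · rw [← hlast]
    simp only [content]
    ring
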